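/- Let $\mathcal X$ be a measurable space and let $P$ be any probability distribution on $\mathcal X\times[0,1]$. For measurable $f:\mathcal X\to[0,1]$ let $$\Delta_{\mathrm{Cutoff}}^P(f)=\sup_{I\text{ interval}}\Big|\mathbb E_{(X,Y)\sim P}\big[(Y-f(X))\mathbf 1\{f(X)\in I\}\big]\Big|,$$ the supremum being over all intervals $I\subseteq\mathbb R$ (open, closed or half-open, possibly degenerate); when $f$ is data-dependent, the expectation is over a fresh draw $(X,Y)\sim P$ with $f$ held fixed. Let $n\ge 2$, $\delta\in(0,1)$, $c>0$, and let $\mathcal A:(\mathcal X\times[0,1])^{\lceil n/2\rceil}\to\{\text{measurable functions }\mathcal X\to[0,1]\}$ be any model fitting algorithm. Given $(X_1,Y_1),\dots,(X_n,Y_n)$ drawn i.i.d. from $P$, consider the following procedure. 1. Train $f_{n,\mathrm{init}}=\mathcal A\big((X_1,Y_1),\dots,(X_{\lceil n/2\rceil},Y_{\lceil n/2\rceil})\big)$. 2. Compute $$\widehat\Delta_{\mathrm{Cutoff}}(f_{n,\mathrm{init}})=\sup_{I\text{ interval}}\Big|\frac1{\lfloor n/2\rfloor}\sum_{i=\lceil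 n/2\rceil+1}^n (Y_i-f_{n,\mathrm{init}}(X_i))\mathbf 1\{f_{n,\mathrm{init}}(X_i)\in I\}\Big|.$$ 3. If $\widehat\Delta_{\mathrm{Cutoff}}(f_{n,\mathrm{init}})\le c-\frac{20+\sqrt{2\log(1/\delta)}}{\sqrt{\lfloor n/2\rfloor}}$, return $f_n=f_{n,\mathrm{init}}$; otherwise return the constant function $f_n(x)\equiv\frac1{\lfloor n/2\rfloor}\sum_{i=\lceil n/2\rceil+1}^n Y_i$. If $c\ge\sqrt{\frac{\log(1/\delta)}{2\lfloor n/2\rfloor}}$, then $$\mathbb P\{\Delta_{\mathrm{Cutoff}}^P(f_n)\le c\}\ge 1-2\delta,$$ where $\mathbb P=P^n$ is the law of the data (read as outer measure if $\mathcal A$ is so irregular that the event is not measurable). -/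

import Mathlib

open MeasureTheory

noncomputable section

/-- The Cutoff Calibration Error of a forecast `f` under the joint law `P` of `(X, Y)`:
the supremum over all intervals `I` of `|E[(Y - f(X)) 1{f(X) ∈ I}]|`, with `f` held fixed.
An interval is an order-connected set of reals, with any kind of endpoints. -/
def cutoffError {𝒳 : Type*} [MeasurableSpace 𝒳] (P : Measure (𝒳 × unitInterval))
    (f : 𝒳 → ℝ) : ℝ :=
  ⨆ I : {I : Set ℝ // I.OrdConnected},
    |∫ z, (f ⁻¹' I.1).indicator (fun x => (z.2 : ℝ) - f x) z.1 ∂P|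

/-- The plug-in estimator of the Cutoff Calibration Error of `f` from a sample of size `m`. -/
def cutoffEstimate {𝒳 : Type*} {m : ℕ} (s : Fin m → 𝒳 × unitInterval) (f : 𝒳 → ℝ) : ℝ :=
  ⨆ I : {I : Set ℝ // I.OrdConnected},
    |(1 / (m : ℝ)) * ∑ i, (f ⁻¹' I.1).indicator (fun x => ((s i).2 : ℝ) - f x) (s i).1|

/-- The first `⌈n/2⌉` data points. -/
def firstHalf {α : Type*} {n : ℕ} (s : Fin n → α) : Fin ((n + 1) / 2) → α :=
  fun i => s ⟨i, by omega⟩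

/-- The last `⌊n/2⌋` data points, those with (one-based) index `⌈n/2⌉ + 1, …, n`. -/
def secondHalf {α : Type*} {n : ℕ} (s : Fin n → α) : Fin (n / 2) → α :=
  fun i => s ⟨(n + 1) / 2 + i, by omega⟩

/-- The empirical mean of the responses. -/
def responseMean {𝒳 : Type*} {m : ℕ} (s : Fin m → 𝒳 × unitInterval) : ℝ :=
  (1 / (m : ℝ)) * ∑ i, ((s i).2 : ℝ)

open Classical in
/-- The sample-splitting procedure: train `f_init` by the algorithm `A` on the first half of the
data, estimate its Cutoff Calibration Error on the second half, and return `f_init` if the estimate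
is at most `c - (20 + √(2 log (1/δ))) / √⌊n/2⌋`; otherwise return the constant function equal to
the mean response of the second half. -/
def splitProcedure {𝒳 : Type*} [MeasurableSpace 𝒳] {n : ℕ}
    (A : (Fin ((n + 1) / 2) → 𝒳 × unitInterval) → {f : 𝒳 → unitInterval // Measurable f})
    (c δ : ℝ) (s : Fin n → 𝒳 × unitInterval) : 𝒳 → ℝ :=
  let fInit : 𝒳 → ℝ := fun x => ((A (firstHalf s)).1 x : ℝ)
  if cutoffEstimate (secondHalf s) fInit
      ≤ c - (20 + √(2 * Real.log (1 / δ))) / √((n / 2 : ℕ) : ℝ) then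
    fInit
  else
    fun _ => responseMean (secondHalf s)

end

/-! Freeze the training half, so that the forecast is fixed and the other `m` points are i.i.d. Let
`D` be the largest gap, over intervals, between empirical and true mean of the residual on that
interval. An interval is a difference of two half-lines of forecast values; after sorting the sample
by forecast, a half-line selects an initial segment. So symmetrization reduces `E D` to the running
maximum of a signed walk, and Doob's `L²` inequality gives `E D ≤ 8/√m` without chaining or a
logarithm. McDiarmid then bounds the probability of `D ≥ (8 + r)/√m` by `exp (-r²/2)`
(`measure_uniformDeviation_halfLineDiff_ge_le`).

If the trained forecast is returned, its error is at most the estimate plus `D`. If the constant is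
returned, its error is only its bias, which Hoeffding controls (`measure_responseMean_ge_le`).
`measure_cutoffError_selected_gt_le` combines the two, and `ofReal_le_measure_of_forall_section`
removes the conditioning. -/

/-! ### Bounded differences -/

/-- Hoeffding's lemma in terms of oscillation: the range lies in `[inf G, inf G + b]`. The
martingale induction supplies only an oscillation bound. -/
theorem integral_exp_le_of_abs_sub_le {Ω : Type*} [MeasurableSpace Ω] (P : Measure Ω)
    [IsProbabilityMeasure P] {b : ℝ} {G : Ω → ℝ} (hG : Measurable G)
    (hb : ∀ x y, |G x - G y| ≤ b) (t : ℝ) :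
    ∫ x, Real.exp (t * G x) ∂P ≤ Real.exp (t * ∫ x, G x ∂P + b ^ 2 * t ^ 2 / 8) := by
  obtain ⟨x₀⟩ := nonempty_of_isProbabilityMeasure P
  have hbdd : BddBelow (Set.range G) := ⟨G x₀ - b, by
    rintro _ ⟨x, rfl⟩; linarith [(abs_le.1 (hb x x₀)).1]⟩
  have : Nonempty Ω := ⟨x₀⟩
  set a := ⨅ x, G x with ha
  have hmem : ∀ x, G x ∈ Set.Icc a (a + b) := fun x => ⟨ciInf_le hbdd x, by
    have : G x - b ≤ a := le_ciInf fun y => by linarith [(abs_le.1 (hb x y)).2]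
    linarith⟩
  have h := (ProbabilityTheory.hasSubgaussianMGF_of_mem_Icc (μ := P) hG.aemeasurable
    (ae_of_all _ hmem)).mgf_le t
  rw [ProbabilityTheory.mgf] at h
  have e1 : ∀ x, Real.exp (t * G x) =
      Real.exp (t * ∫ y, G y ∂P) * Real.exp (t * (G x - ∫ y, G y ∂P)) := fun x => by
    rw [← Real.exp_add]; ring_nf
  simp_rw [e1]
  rw [integral_const_mul, Real.exp_add]
  refine mul_le_mul_of_nonneg_left (h.trans (le_of_eq ?_)) (Real.exp_pos _).le
  congr 1
  simp only [NNReal.coe_pow, NNReal.coe_div, coe_nnnorm, Real.norm_eq_abs, NNReal.coe_ofNat,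
    add_sub_cancel_left, div_pow, sq_abs]
  ring

theorem integrable_of_abs_le {Ω : Type*} [MeasurableSpace Ω] {P : Measure Ω}
    [IsFiniteMeasure P] {F : Ω → ℝ} (hF : Measurable F) {K : ℝ} (hK : ∀ s, |F s| ≤ K) :
    Integrable F P :=
  Integrable.of_bound hF.aestronglyMeasurable K (ae_of_all _ fun s => by simpa using hK s)

/-- The exponential moment bound behind McDiarmid's bounded differences inequality. -/
theorem integral_exp_le_of_bounded_differences {Ω : Type*} [MeasurableSpace Ω] (P : Measure Ω)
    [IsProbabilityMeasure P] {b : ℝ} (t : ℝ) : ∀ (m : ℕ) (F : (Fin m → Ω) → ℝ), Measurable F →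
    ∀ K, (∀ s, |F s| ≤ K) → (∀ s i x, |F (Function.update s i x) - F s| ≤ b) →
    ∫ s, Real.exp (t * F s) ∂(Measure.pi fun _ => P) ≤
      Real.exp (t * ∫ s, F s ∂(Measure.pi fun _ => P) + m * (b ^ 2 * t ^ 2 / 8)) := by
  intro m
  induction m with
  | zero =>
    intro F hF K hK hb
    have : ∀ s, F s = F (fun i => i.elim0) := fun s => by congr 1; ext i; exact i.elim0
    simp_rw [this]
    simp
  | succ m ih =>
    intro F hF K hK hb
    set e := MeasurableEquiv.piFinSuccAbove (fun _ : Fin (m + 1) => Ω) 0 with he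
    have mp : MeasurePreserving e.symm (P.prod (Measure.pi fun _ : Fin m => P))
        (Measure.pi fun _ : Fin (m + 1) => P) :=
      (measurePreserving_piFinSuccAbove (fun _ : Fin (m + 1) => P) 0).symm e
    have hes : ∀ x s, e.symm (x, s) = Fin.cons x s := fun x s => by
      simp [he, MeasurableEquiv.piFinSuccAbove, Fin.insertNthEquiv]
    have hFm : Measurable fun p : Ω × (Fin m → Ω) => F (e.symm p) := hF.comp e.symm.measurable
    have hFx : ∀ x, Measurable fun s => F (e.symm (x, s)) := fun x =>
      hFm.comp measurable_prodMk_left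
    have hexp : ∀ y, |y| ≤ K → |Real.exp (t * y)| ≤ Real.exp (|t| * K) := fun y hy => by
      rw [Real.abs_exp]
      refine Real.exp_le_exp.2 ((le_abs_self _).trans ?_)
      rw [abs_mul]
      gcongr
    -- The conditional expectation given the first coordinate. It inherits the oscillation bound
    -- `b`; the induction hypothesis treats the remaining coordinates with the first one frozen.
    set G : Ω → ℝ := fun x => ∫ s, F (e.symm (x, s)) ∂(Measure.pi fun _ => P) with hG
    have hGm : Measurable G :=
      (StronglyMeasurable.integral_prod_right (f := fun x s => F (e.symm (x, s)))
        hFm.stronglyMeasurable).measurable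
    have hint : ∀ x, Integrable (fun s => F (e.symm (x, s))) (Measure.pi fun _ => P) := fun x =>
      integrable_of_abs_le (hFx x) fun s => hK _
    have hGK : ∀ x, |G x| ≤ K := fun x => by
      have := norm_integral_le_of_norm_le_const (μ := Measure.pi fun _ : Fin m => P)
        (f := fun s => F (e.symm (x, s))) (C := K) (ae_of_all _ fun s => by simpa using hK _)
      simpa using this
    have hGb : ∀ x y, |G x - G y| ≤ b := fun x y => by
      rw [hG]
      simp only
      rw [← integral_sub (hint x) (hint y)]
      have := norm_integral_le_of_norm_le_const (μ := Measure.pi fun _ : Fin m => P)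
        (f := fun s => F (e.symm (x, s)) - F (e.symm (y, s))) (C := b) (ae_of_all _ fun s => by
          have h := hb (e.symm (y, s)) 0 x
          rw [hes, Fin.update_cons_zero] at h
          rw [hes, hes]
          simpa using h)
      simpa using this
    have key : ∫ x, ∫ s, Real.exp (t * F (e.symm (x, s))) ∂(Measure.pi fun _ => P) ∂P ≤
        ∫ x, Real.exp (t * G x) * Real.exp (m * (b ^ 2 * t ^ 2 / 8)) ∂P := by
      refine integral_mono ?_ ?_ fun x => ?_
      · exact (integrable_of_abs_le (Real.measurable_exp.comp (hFm.const_mul t))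
          (fun p => hexp _ (hK _))).integral_prod_left
      · exact (integrable_of_abs_le (Real.measurable_exp.comp (hGm.const_mul t))
          (fun p => hexp _ (hGK _))).mul_const _
      · simp only
        rw [← Real.exp_add]
        refine ih (fun s => F (e.symm (x, s))) (hFx x) K (fun s => hK _) fun s i y => ?_
        have h := hb (e.symm (x, s)) i.succ y
        rw [hes, ← Fin.cons_update] at h
        simpa only [hes] using h
    rw [← mp.integral_comp', ← mp.integral_comp', integral_prod, integral_prod]
    · refine key.trans ?_
      rw [integral_mul_const]
      refine (mul_le_mul_of_nonneg_right (integral_exp_le_of_abs_sub_le P hGm hGb t)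
        (Real.exp_pos _).le).trans (le_of_eq ?_)
      rw [← Real.exp_add]
      congr 1
      push_cast
      ring
    · exact integrable_of_abs_le hFm fun p => hK _
    · exact integrable_of_abs_le (Real.measurable_exp.comp (hFm.const_mul t))
          (fun p => hexp _ (hK _))

/-- McDiarmid's inequality with equal difference bounds. -/
theorem measure_ge_le_of_bounded_differences {Ω : Type*} [MeasurableSpace Ω] (P : Measure Ω)
    [IsProbabilityMeasure P] {b : ℝ} {m : ℕ} {F : (Fin m → Ω) → ℝ} (hF : Measurable F)
    {K : ℝ} (hK : ∀ s, |F s| ≤ K) (hb : ∀ s i x, |F (Function.update s i x) - F s| ≤ b)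
    (hm : 0 < m) (hb0 : 0 < b) {r : ℝ} (hr : 0 ≤ r) :
    (Measure.pi fun _ => P).real {s | (∫ s, F s ∂(Measure.pi fun _ => P)) + r ≤ F s} ≤
      Real.exp (-(2 * r ^ 2 / (m * b ^ 2))) := by
  set E := ∫ s, F s ∂(Measure.pi fun _ => P) with hE
  have hm' : (0 : ℝ) < m := by exact_mod_cast hm
  -- The minimizer of `-t r + m b² t² / 8`.
  set t := 4 * r / (m * b ^ 2) with ht
  have ht0 : 0 ≤ t := by positivity
  have hint : Integrable (fun s => Real.exp (t * F s)) (Measure.pi fun _ => P) :=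
    integrable_of_abs_le (K := Real.exp (t * K)) (Real.measurable_exp.comp (hF.const_mul t))
      fun s => by
        rw [Real.abs_exp]
        exact Real.exp_le_exp.2 (mul_le_mul_of_nonneg_left (abs_le.1 (hK s)).2 ht0)
  have h1 := ProbabilityTheory.measure_ge_le_exp_mul_mgf (X := F) (E + r) ht0 hint
  refine h1.trans ?_
  rw [ProbabilityTheory.mgf]
  refine (mul_le_mul_of_nonneg_left (integral_exp_le_of_bounded_differences P t m F hF K hK hb)
    (Real.exp_pos _).le).trans ?_
  rw [← Real.exp_add, Real.exp_le_exp]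
  rw [ht]
  apply le_of_eq
  field_simp
  ring

/-! ### Signed walks and a maximal inequality -/

/-- The sign `±1` encoded by a Boolean. -/
def boolSign (b : Bool) : ℝ := if b then 1 else -1

theorem sum_bool_cons {m : ℕ} (f : (Fin (m + 1) → Bool) → ℝ) :
    ∑ ε, f ε = ∑ ε, f (Fin.cons true ε) + ∑ ε, f (Fin.cons false ε) := by
  rw [← Equiv.sum_comp (Fin.consEquiv fun _ : Fin (m + 1) => Bool) f, Fintype.sum_prod_type]
  simp [Fin.consEquiv]

theorem sum_sq_add_signed_sum {m : ℕ} (a : Fin m → ℝ) (x : ℝ) :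
    ∑ ε : Fin m → Bool, (x + ∑ i, boolSign (ε i) * a i) ^ 2 = 2 ^ m * (x ^ 2 + ∑ i, a i ^ 2) := by
  induction m generalizing x with
  | zero => simp
  | succ m ih =>
    rw [sum_bool_cons]
    simp_rw [Fin.sum_univ_succ, Fin.cons_zero, Fin.cons_succ, ← add_assoc]
    rw [ih (fun i => a i.succ), ih (fun i => a i.succ)]
    simp [boolSign]
    ring

/-- The potential `2M|x| - M²` of a walk at `x` with running maximum `M`. The left side is `2M|y| -
M²`; if `M` rises to `|y|` the gain is `(|y| - M)²`. -/
theorem doob_step {x M y : ℝ} : 2 * M * |x| - M ^ 2 + 2 * M * (|y| - |x|) ≤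
    2 * max M |y| * |y| - max M |y| ^ 2 := by
  rcases le_total M |y| with h | h
  · rw [max_eq_right h]; nlinarith [sq_nonneg (|y| - M)]
  · rw [max_eq_left h]; linarith

/-- A running maximum of a signed walk satisfies the pathwise form of Doob's `L²` inequality on
average over the signs. -/
theorem exists_running_max {m : ℕ} (a : Fin m → ℝ) (x M : ℝ) (hM : |x| ≤ M) :
    ∃ R : (Fin m → Bool) → ℝ,
      (∀ ε, M ≤ R ε) ∧
      (∀ ε (k : ℕ), |x + ∑ i : Fin m, if (i : ℕ) < k then boolSign (ε i) * a i else 0| ≤ R ε) ∧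
      2 ^ m * (2 * M * |x| - M ^ 2) ≤
        ∑ ε, (2 * R ε * |x + ∑ i, boolSign (ε i) * a i| - R ε ^ 2) := by
  induction m generalizing x M with
  | zero => exact ⟨fun _ => M, fun _ => le_rfl, by simpa using hM, by simp⟩
  | succ m ih =>
    have hM0 : 0 ≤ M := (abs_nonneg x).trans hM
    have H : ∀ b : Bool, ∃ R : (Fin m → Bool) → ℝ, (∀ ε, max M |x + boolSign b * a 0| ≤ R ε) ∧
      (∀ ε (k : ℕ), |(x + boolSign b * a 0) +
        ∑ i : Fin m, if (i : ℕ) < k then boolSign (ε i) * a i.succ else 0| ≤ R ε) ∧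
      2 ^ m * (2 * max M |x + boolSign b * a 0| * |x + boolSign b * a 0| -
          max M |x + boolSign b * a 0| ^ 2) ≤
        ∑ ε, (2 * R ε * |(x + boolSign b * a 0) + ∑ i : Fin m, boolSign (ε i) * a i.succ|
          - R ε ^ 2) :=
      fun b => ih (fun i => a i.succ) _ _ (le_max_right _ _)
    choose R h1 h2 h3 using H
    refine ⟨fun ε => R (ε 0) (fun i => ε i.succ), fun ε => (le_max_left _ _).trans (h1 _ _), ?_, ?_⟩
    · rintro ε (_ | k)
      · simpa using hM.trans ((le_max_left _ _).trans (h1 (ε 0) fun i => ε i.succ))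
      · have := h2 (ε 0) (fun i => ε i.succ) k
        simpa [Fin.sum_univ_succ, ← add_assoc] using this
    · rw [sum_bool_cons]
      simp_rw [Fin.sum_univ_succ, Fin.cons_zero, Fin.cons_succ, ← add_assoc]
      refine le_trans ?_ (add_le_add (h3 true) (h3 false))
      rw [← mul_add, pow_succ, mul_assoc]
      refine mul_le_mul_of_nonneg_left ?_ (by positivity)
      have s1 := doob_step (x := x) (M := M) (y := x + boolSign true * a 0)
      have s2 := doob_step (x := x) (M := M) (y := x + boolSign false * a 0)
      -- The submartingale property of `|x|`: the linear increments in `doob_step` are nonnegative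
      -- on average over the two signs.
      have s3 : 2 * |x| ≤ |x + boolSign true * a 0| + |x + boolSign false * a 0| := by
        have := abs_add_le (x + boolSign true * a 0) (x + boolSign false * a 0)
        have e : x + boolSign true * a 0 + (x + boolSign false * a 0) = 2 * x := by
          simp [boolSign]; ring
        rw [e, abs_mul, abs_two] at this
        exact this
      nlinarith [mul_le_mul_of_nonneg_left s3 hM0]

/-- Starting the potential at zero gives `∑ R² ≤ 2 ∑ R |S|`, with `S` the endpoint of the walk,
whose mean square is at most `m`. -/
theorem exists_initial_segment_bound {m : ℕ} (hm : 0 < m) (a : Fin m → ℝ) (ha : ∀ i, |a i| ≤ 1) :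
    ∃ R : (Fin m → Bool) → ℝ,
      (∀ ε (k : ℕ), |∑ i : Fin m, if (i : ℕ) < k then boolSign (ε i) * a i else 0| ≤ R ε) ∧
      ∑ ε, R ε ≤ 2 ^ m * (2 * √(m : ℝ)) := by
  obtain ⟨R, -, h2, h3⟩ := exists_running_max a 0 0 (by simp)
  refine ⟨R, by simpa using h2, ?_⟩
  have hm' : (0 : ℝ) < m := by exact_mod_cast hm
  have hs : 0 < √(m : ℝ) := Real.sqrt_pos.2 hm'
  have hss : √(m : ℝ) * √(m : ℝ) = m := Real.mul_self_sqrt hm'.le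
  have hv := sum_sq_add_signed_sum a 0
  have hle : ∑ i, a i ^ 2 ≤ m := by
    calc ∑ i, a i ^ 2 ≤ ∑ i : Fin m, (1 : ℝ) := Finset.sum_le_sum fun i _ => by
            rw [← sq_abs]; exact pow_le_one₀ (abs_nonneg _) (ha i)
      _ = m := by simp
  simp only [zero_add, abs_zero, mul_zero, ne_eq, OfNat.ofNat_ne_zero, not_false_eq_true, zero_pow,
    sub_zero] at h3 hv
  have hp : (0 : ℝ) < 2 ^ m := by positivity
  -- The slack is `(R - 2|S|)²/4 + (R - 2√m)²/4`. This linearization replaces two uses of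
  -- Cauchy–Schwarz.
  have key : ∀ ε, √(m : ℝ) * R ε ≤
      (√m * √m) + ((∑ i, boolSign (ε i) * a i) ^ 2
        - (2 * R ε * |∑ i, boolSign (ε i) * a i| - R ε ^ 2) / 2) := fun ε => by
    rw [← sq_abs (∑ i, boolSign (ε i) * a i)]
    nlinarith [sq_nonneg (R ε - 2 * |∑ i, boolSign (ε i) * a i|), sq_nonneg (R ε - 2 * √m)]
  have hsum := Finset.sum_le_sum fun ε (_ : ε ∈ Finset.univ) => key ε
  rw [← Finset.mul_sum, Finset.sum_add_distrib, Finset.sum_sub_distrib, ← Finset.sum_div, hv,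
    hss] at hsum
  simp only [Finset.sum_const, Finset.card_univ, Fintype.card_pi, Fintype.card_bool,
    Finset.prod_const, Fintype.card_fin, nsmul_eq_mul, Nat.cast_pow, Nat.cast_ofNat] at hsum
  have : √(m : ℝ) * ∑ ε, R ε ≤ √(m : ℝ) * (2 ^ m * (2 * √(m : ℝ))) := by
    have e : √(m : ℝ) * (2 ^ m * (2 * √(m : ℝ))) = 2 ^ m * (2 * m) := by
      rw [show √(m : ℝ) * (2 ^ m * (2 * √(m : ℝ))) = 2 ^ m * (2 * (√(m : ℝ) * √(m : ℝ))) by ring, hss]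
    rw [e]
    nlinarith [mul_le_mul_of_nonneg_left hle hp.le]
  exact le_of_mul_le_mul_left this hs

/-! ### Symmetrization -/

/-- The uniform deviation between the empirical means and the expectations of the functions `g t`. -/
noncomputable def uniformDeviation {Ω ι : Type*} [MeasurableSpace Ω] (P : Measure Ω) (g : ι → Ω → ℝ) {m : ℕ}
    (s : Fin m → Ω) : ℝ :=
  ⨆ t, |(1 / (m : ℝ)) * ∑ i, g t (s i) - ∫ z, g t z ∂P|

theorem bddAbove_range_of_abs_le {ι : Type*} {u : ι → ℝ} {K : ℝ} (h : ∀ t, |u t| ≤ K) :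
    BddAbove (Set.range fun t => |u t|) :=
  ⟨K, by rintro _ ⟨t, rfl⟩; exact h t⟩

theorem abs_iSup_abs_le {ι : Type*} [Nonempty ι] {u : ι → ℝ} {K : ℝ} (h : ∀ t, |u t| ≤ K) :
    |(⨆ t, |u t|)| ≤ K := by
  rw [abs_of_nonneg (Real.iSup_nonneg fun t => abs_nonneg _)]
  exact ciSup_le h

theorem abs_mean_le {m : ℕ} {u : Fin m → ℝ} {K : ℝ} (hK : 0 ≤ K) (h : ∀ i, |u i| ≤ K) :
    |(1 / (m : ℝ)) * ∑ i, u i| ≤ K := by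
  rcases Nat.eq_zero_or_pos m with rfl | hm
  · simpa using hK
  have hm' : (0 : ℝ) < m := by exact_mod_cast hm
  rw [abs_mul, abs_of_nonneg (by positivity), one_div, inv_mul_le_iff₀ hm']
  calc |∑ i, u i| ≤ ∑ i, |u i| := Finset.abs_sum_le_sum_abs _ _
    _ ≤ ∑ i : Fin m, K := Finset.sum_le_sum fun i _ => h i
    _ = m * K := by simp

theorem abs_integral_le_of_abs_le {Ω : Type*} [MeasurableSpace Ω] {P : Measure Ω}
    [IsProbabilityMeasure P] {h : Ω → ℝ} {K : ℝ} (hK : ∀ z, |h z| ≤ K) : |∫ z, h z ∂P| ≤ K := by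
  simpa using norm_integral_le_of_norm_le_const (μ := P) (f := h) (C := K)
    (ae_of_all _ fun z => by simpa using hK z)

section

variable {Ω ι : Type*} {g : ι → Ω → ℝ} {m : ℕ}

theorem abs_sum_update_sub_le {h : Ω → ℝ} {K : ℝ} (hK : ∀ x y, |h x - h y| ≤ K) (s : Fin m → Ω)
    (i : Fin m) (x : Ω) :
    |(1 / (m : ℝ)) * ∑ j, h (Function.update s i x j) - (1 / (m : ℝ)) * ∑ j, h (s j)| ≤ K / m := by
  have e : ∑ j, h (Function.update s i x j) - ∑ j, h (s j) = h x - h (s i) := by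
    rw [← Finset.sum_sub_distrib, Finset.sum_eq_single i]
    · simp
    · intro j _ hj; simp [Function.update_of_ne hj]
    · simp
  rw [← mul_sub, e, abs_mul, abs_of_nonneg (by positivity), one_div, inv_mul_eq_div]
  gcongr
  exact hK _ _

/-- The signed two-sample deviation. -/
noncomputable def signedDeviation (g : ι → Ω → ℝ) (ε : Fin m → Bool) (z : Fin m → Ω × Ω) : ℝ :=
  ⨆ t, |(1 / (m : ℝ)) * ∑ i, boolSign (ε i) * (g t (z i).1 - g t (z i).2)|

theorem abs_boolSign (b : Bool) : |boolSign b| = 1 := by cases b <;> simp [boolSign]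

theorem abs_signed_term_le (hg1 : ∀ t z, |g t z| ≤ 1) (ε : Fin m → Bool) (z : Fin m → Ω × Ω)
    (t : ι) : |(1 / (m : ℝ)) * ∑ i, boolSign (ε i) * (g t (z i).1 - g t (z i).2)| ≤ 2 :=
  abs_mean_le zero_le_two fun i => by
    rw [abs_mul, abs_boolSign, one_mul]
    exact (abs_sub _ _).trans (by linarith [hg1 t (z i).1, hg1 t (z i).2])

end

section

variable {Ω ι : Type*} [MeasurableSpace Ω] {P : Measure Ω} {g : ι → Ω → ℝ} {m : ℕ}

theorem measurable_signedDeviation [Countable ι] (hg : ∀ t, Measurable (g t)) (ε : Fin m → Bool) :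
    Measurable (signedDeviation g ε) := by
  refine Measurable.iSup fun t => (continuous_abs.measurable).comp ?_
  refine (Finset.measurable_sum _ fun i _ => ?_).const_mul _
  have h := (measurable_pi_apply (X := fun _ : Fin m => Ω × Ω) i)
  exact (((hg t).comp h.fst).sub ((hg t).comp h.snd)).const_mul _

theorem measurable_uniformDeviation [Countable ι] (hg : ∀ t, Measurable (g t)) :
    Measurable (uniformDeviation P g (m := m)) := by
  refine Measurable.iSup fun t => ?_
  refine (continuous_abs.measurable).comp ?_
  exact ((Finset.measurable_sum _ fun i _ => (hg t).comp (measurable_pi_apply i)).const_mul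
    _).sub_const _

end

section

variable {Ω ι : Type*} [MeasurableSpace Ω] {P : Measure Ω} [IsProbabilityMeasure P]
  {g : ι → Ω → ℝ} {m : ℕ}

theorem abs_deviation_le_two (hg1 : ∀ t z, |g t z| ≤ 1) (s : Fin m → Ω) (t : ι) :
    |(1 / (m : ℝ)) * ∑ i, g t (s i) - ∫ z, g t z ∂P| ≤ 2 := by
  have h1 := abs_mean_le (m := m) zero_le_one fun i => hg1 t (s i)
  have h2 := abs_integral_le_of_abs_le (P := P) (hg1 t)
  exact (abs_sub _ _).trans (by linarith)

theorem abs_deviation_le_uniformDeviation (hg1 : ∀ t z, |g t z| ≤ 1) (s : Fin m → Ω) (t : ι) :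
    |(1 / (m : ℝ)) * ∑ i, g t (s i) - ∫ z, g t z ∂P| ≤ uniformDeviation P g s :=
  le_ciSup (bddAbove_range_of_abs_le fun t => abs_deviation_le_two (P := P) hg1 s t) t

theorem abs_uniformDeviation_le_two [Nonempty ι] (hg1 : ∀ t z, |g t z| ≤ 1) (s : Fin m → Ω) :
    |uniformDeviation P g s| ≤ 2 :=
  abs_iSup_abs_le fun t => abs_deviation_le_two (P := P) hg1 s t

theorem abs_uniformDeviation_update_sub_le [Nonempty ι] (hg1 : ∀ t z, |g t z| ≤ 1)
    (s : Fin m → Ω) (i : Fin m) (x : Ω) :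
    |uniformDeviation P g (Function.update s i x) - uniformDeviation P g s| ≤ 2 / m := by
  have key : ∀ s' s'' : Fin m → Ω, (∀ t, |(1 / (m : ℝ)) * ∑ j, g t (s' j) -
      (1 / (m : ℝ)) * ∑ j, g t (s'' j)| ≤ 2 / m) →
      uniformDeviation P g s' ≤ uniformDeviation P g s'' + 2 / m := fun s' s'' h => by
    refine ciSup_le fun t => ?_
    have h1 := abs_deviation_le_uniformDeviation (P := P) hg1 s'' t
    have h2 := abs_add_le ((1 / (m : ℝ)) * ∑ j, g t (s' j) - (1 / (m : ℝ)) * ∑ j, g t (s'' j))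
      ((1 / (m : ℝ)) * ∑ i, g t (s'' i) - ∫ z, g t z ∂P)
    rw [sub_add_sub_cancel] at h2
    linarith [h t]
  have hd : ∀ t x y, |g t x - g t y| ≤ 2 := fun t x y =>
    (abs_sub _ _).trans (by linarith [hg1 t x, hg1 t y])
  have h1 := key (Function.update s i x) s fun t => abs_sum_update_sub_le (hd t) s i x
  have h2 := key s (Function.update s i x) fun t => by
    rw [abs_sub_comm]; exact abs_sum_update_sub_le (hd t) s i x
  rw [abs_le]
  constructor <;> linarith

theorem integrable_signedDeviation [Countable ι] [Nonempty ι] (hg : ∀ t, Measurable (g t))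
    (hg1 : ∀ t z, |g t z| ≤ 1) (ε : Fin m → Bool) :
    Integrable (signedDeviation g ε) (Measure.pi fun _ => P.prod P) :=
  integrable_of_abs_le (measurable_signedDeviation hg ε) (K := 2)
    fun z => abs_iSup_abs_le fun t => abs_signed_term_le hg1 ε z t

/-- Swapping the two members of a pair preserves `P.prod P` and flips the sign of its difference. -/
theorem integral_signedDeviation_eq [Countable ι] (hg : ∀ t, Measurable (g t))
    (ε : Fin m → Bool) :
    ∫ z, signedDeviation g ε z ∂(Measure.pi fun _ => P.prod P) =
      ∫ z, signedDeviation g (fun _ : Fin m => true) z ∂(Measure.pi fun _ => P.prod P) := by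
  have mp : MeasurePreserving (fun (z : Fin m → Ω × Ω) i => if ε i then z i else (z i).swap)
      (Measure.pi fun _ => P.prod P) (Measure.pi fun _ => P.prod P) := by
    refine measurePreserving_pi (fun _ => P.prod P) (fun _ => P.prod P)
      (f := fun i z => if ε i then z else z.swap) fun i => ?_
    cases ε i
    · simpa using Measure.measurePreserving_swap
    · exact MeasurePreserving.id (P.prod P)
  rw [← mp.map_eq, integral_map mp.measurable.aemeasurable
    (measurable_signedDeviation hg _).aestronglyMeasurable, mp.map_eq]
  congr 1
  ext z
  simp only [signedDeviation]
  congr 1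
  ext t
  congr 3
  ext i
  cases ε i <;> simp [boolSign]

/-- Ghost sample: each expectation is the mean over an independent copy, and the supremum of
averages is at most the average of suprema. -/
theorem uniformDeviation_le_integral [Countable ι] [Nonempty ι] (hg : ∀ t, Measurable (g t))
    (hg1 : ∀ t z, |g t z| ≤ 1) (hm : 0 < m) (s : Fin m → Ω) :
    uniformDeviation P g s ≤
      ∫ s', signedDeviation g (fun _ => true) (fun i => (s i, s' i)) ∂(Measure.pi fun _ => P) := by
  have hm' : (0 : ℝ) < m := by exact_mod_cast hm
  have hmeas : Measurable fun (s' : Fin m → Ω) i => (s i, s' i) :=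
    measurable_pi_lambda _ fun i => measurable_const.prodMk (measurable_pi_apply i)
  refine ciSup_le fun t => ?_
  have hi : ∀ i : Fin m, Integrable (fun s' : Fin m → Ω => g t (s' i)) (Measure.pi fun _ => P) :=
    fun i => integrable_of_abs_le ((hg t).comp (measurable_pi_apply i)) fun s' => hg1 t _
  have he : ∀ i : Fin m, ∫ s', g t (s' i) ∂(Measure.pi fun _ => P) = ∫ z, g t z ∂P := fun i =>
    integral_comp_eval (μ := fun _ : Fin m => P) (hg t).aestronglyMeasurable
  have h1 : (1 / (m : ℝ)) * ∑ i, g t (s i) - ∫ z, g t z ∂P =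
      ∫ s', (1 / (m : ℝ)) * ∑ i, boolSign true * (g t (s i) - g t (s' i))
        ∂(Measure.pi fun _ => P) := by
    rw [integral_const_mul, integral_finsetSum]
    · simp_rw [boolSign, if_true, one_mul]
      have : ∀ i, ∫ s', (g t (s i) - g t (s' i)) ∂(Measure.pi fun _ : Fin m => P) =
          g t (s i) - ∫ z, g t z ∂P := fun i => by
        rw [integral_sub (integrable_const _) (hi i), he]; simp
      simp_rw [this, Finset.sum_sub_distrib]
      simp only [Finset.sum_const, Finset.card_univ, Fintype.card_fin, nsmul_eq_mul]
      field_simp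
    · exact fun i _ => ((integrable_const _).sub (hi i)).const_mul _
  rw [h1]
  refine (abs_integral_le_integral_abs).trans (integral_mono ?_ ?_ fun s' => ?_)
  · exact ((integrable_finsetSum _ fun i _ =>
      ((integrable_const _).sub (hi i)).const_mul _).const_mul _).abs
  · exact integrable_of_abs_le (K := 2) ((measurable_signedDeviation hg _).comp hmeas)
      fun s' => abs_iSup_abs_le fun t => abs_signed_term_le hg1 _ _ t
  · exact le_ciSup (bddAbove_range_of_abs_le fun t =>
      abs_signed_term_le hg1 (fun _ => true) (fun i => (s i, s' i)) t) t

/-- After averaging over signs, the sample and its ghost are bounded separately, whence the factor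
2. The bound `B` need not depend measurably on the sample, since only its sum over signs is
integrated, as a constant. -/
theorem integral_uniformDeviation_le [Countable ι] [Nonempty ι] (hg : ∀ t, Measurable (g t))
    (hg1 : ∀ t z, |g t z| ≤ 1) (hm : 0 < m) {C : ℝ}
    (hC : ∀ s : Fin m → Ω, ∃ B : (Fin m → Bool) → ℝ,
      (∀ ε t, |∑ i, boolSign (ε i) * g t (s i)| ≤ B ε) ∧ ∑ ε, B ε ≤ 2 ^ m * C) :
    ∫ s, uniformDeviation P g s ∂(Measure.pi fun _ : Fin m => P) ≤ 2 * C / m := by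
  have hm' : (0 : ℝ) < m := by exact_mod_cast hm
  have mp := (measurePreserving_arrowProdEquivProdArrow Ω Ω (Fin m) (fun _ => P) (fun _ => P)).symm
  have hI := integrable_signedDeviation (P := P) (m := m) hg hg1 (fun _ => true)
  have hI' := (mp.integrable_comp hI.aestronglyMeasurable).2 hI
  have step1 : ∫ s, uniformDeviation P g s ∂(Measure.pi fun _ : Fin m => P) ≤
      ∫ z, signedDeviation g (fun _ => true) z ∂(Measure.pi fun _ : Fin m => P.prod P) := by
    rw [← mp.integral_comp']
    refine le_of_le_of_eq ?_ (integral_prod _ hI').symm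
    refine integral_mono ?_ hI'.integral_prod_left fun s => ?_
    · exact integrable_of_abs_le (measurable_uniformDeviation hg) (abs_uniformDeviation_le_two hg1)
    · exact uniformDeviation_le_integral hg hg1 hm s
  refine step1.trans ?_
  have hp : (0 : ℝ) < 2 ^ m := by positivity
  refine le_of_mul_le_mul_left ?_ hp
  calc 2 ^ m * ∫ z, signedDeviation g (fun _ => true) z ∂(Measure.pi fun _ : Fin m => P.prod P)
      = ∑ ε : Fin m → Bool, ∫ z, signedDeviation g ε z ∂(Measure.pi fun _ => P.prod P) := by
        simp_rw [integral_signedDeviation_eq hg]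
        simp
    _ = ∫ z, ∑ ε : Fin m → Bool, signedDeviation g ε z ∂(Measure.pi fun _ => P.prod P) :=
        (integral_finsetSum _ fun ε _ => integrable_signedDeviation hg hg1 ε).symm
    _ ≤ ∫ z, 2 ^ m * (2 * C / m) ∂(Measure.pi fun _ : Fin m => P.prod P) := by
        refine integral_mono
          (integrable_finsetSum _ fun ε _ => integrable_signedDeviation hg hg1 ε)
          (integrable_const _) fun z => ?_
        obtain ⟨B, hB, hBC⟩ := hC fun i => (z i).1
        obtain ⟨B', hB', hBC'⟩ := hC fun i => (z i).2
        calc ∑ ε, signedDeviation g ε z ≤ ∑ ε, (1 / (m : ℝ)) * (B ε + B' ε) := by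
              refine Finset.sum_le_sum fun ε _ => ciSup_le fun t => ?_
              rw [abs_mul, abs_of_nonneg (by positivity)]
              gcongr
              simp_rw [mul_sub, Finset.sum_sub_distrib]
              exact (abs_sub _ _).trans (add_le_add (hB ε t) (hB' ε t))
          _ = (1 / (m : ℝ)) * (∑ ε, B ε + ∑ ε, B' ε) := by
              rw [← Finset.mul_sum, Finset.sum_add_distrib]
          _ ≤ (1 / (m : ℝ)) * (2 ^ m * C + 2 ^ m * C) := by gcongr
          _ = 2 ^ m * (2 * C / m) := by ring
    _ = 2 ^ m * (2 * C / m) := by simp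

end

/-! ### Half-lines and intervals -/

/-- The weight `w` restricted to the difference of the half-lines `v < p` and `v < q`. -/
noncomputable def halfLineDiff {Ω : Type*} (v w : Ω → ℝ) (t : ℚ × ℚ) (z : Ω) : ℝ :=
  (if v z < t.1 then w z else 0) - (if v z < t.2 then w z else 0)

theorem exists_initial_segment_of_monotone {m : ℕ} {u : Fin m → ℝ} (hu : Monotone u) (q : ℝ) :
    ∃ k : ℕ, ∀ j : Fin m, u j < q ↔ (j : ℕ) < k := by
  classical
  have hex : ∃ k : ℕ, ∀ j : Fin m, k ≤ j → q ≤ u j := ⟨m, fun j hj => absurd j.2 (by omega)⟩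
  refine ⟨Nat.find hex, fun j => ⟨fun h => ?_, fun h => ?_⟩⟩
  · by_contra hk
    exact absurd (Nat.find_spec hex j (not_lt.1 hk)) (not_le.2 h)
  · by_contra hq
    exact Nat.find_min hex h fun i hi => (not_lt.1 hq).trans (hu (Fin.le_def.2 hi))

section

variable {Ω : Type*} {v w : Ω → ℝ}

theorem abs_halfLineDiff_le (hw : ∀ z, |w z| ≤ 1) (t : ℚ × ℚ) (z : Ω) :
    |halfLineDiff v w t z| ≤ 1 := by
  unfold halfLineDiff
  split_ifs <;> simp [hw z]

theorem measurable_halfLineDiff [MeasurableSpace Ω] (hv : Measurable v) (hw : Measurable w)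
    (t : ℚ × ℚ) : Measurable (halfLineDiff v w t) :=
  (Measurable.ite (measurableSet_lt hv measurable_const) hw measurable_const).sub
    (Measurable.ite (measurableSet_lt hv measurable_const) hw measurable_const)

/-- In the order sorted by `v`, each half-line sum is a partial sum of one signed walk. Each of the
two half-lines costs `2√m`. Permuting the signs does not change the sum over all of them. -/
theorem exists_signed_halfLineDiff_bound {m : ℕ} (hm : 0 < m) (hw : ∀ z, |w z| ≤ 1)
    (s : Fin m → Ω) : ∃ B : (Fin m → Bool) → ℝ,
      (∀ ε t, |∑ i, boolSign (ε i) * halfLineDiff v w t (s i)| ≤ B ε) ∧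
      ∑ ε, B ε ≤ 2 ^ m * (4 * √(m : ℝ)) := by
  set σ := Tuple.sort (v ∘ s) with hσ
  have hmono : Monotone ((v ∘ s) ∘ σ) := Tuple.monotone_sort _
  obtain ⟨R, hR, hRs⟩ := exists_initial_segment_bound hm (fun j => w (s (σ j))) fun j => hw _
  have half : ∀ (ε : Fin m → Bool) (q : ℚ),
      |∑ i, boolSign (ε i) * (if v (s i) < q then w (s i) else 0)| ≤ R (ε ∘ σ) := fun ε q => by
    obtain ⟨k, hk⟩ := exists_initial_segment_of_monotone hmono (q : ℝ)
    have := hR (ε ∘ σ) k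
    rw [← Equiv.sum_comp σ]
    convert this using 3 with j
    have hj := hk j
    simp only [Function.comp_apply] at hj ⊢
    simp only [hj, mul_ite, mul_zero]
  refine ⟨fun ε => 2 * R (ε ∘ σ), fun ε t => ?_, ?_⟩
  · simp_rw [halfLineDiff, mul_sub, Finset.sum_sub_distrib]
    exact (abs_sub _ _).trans (by linarith [half ε t.1, half ε t.2])
  · rw [← Finset.mul_sum]
    have : ∑ ε : Fin m → Bool, R (ε ∘ σ) = ∑ ε, R ε :=
      Equiv.sum_comp (Equiv.arrowCongr σ.symm (Equiv.refl Bool)) R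
    rw [this]
    linarith

end

/-- Rationals decrease to an attained supremum or increase to an unattained one, so a countable
family captures both endpoint types. -/
theorem exists_rat_seq_of_isLowerSet {L : Set ℝ} (hL : IsLowerSet L) :
    ∃ q : ℕ → ℚ, ∀ x : ℝ, ∀ᶠ k in Filter.atTop, x < q k ↔ x ∈ L := by
  rcases L.eq_empty_or_nonempty with rfl | hne
  · refine ⟨fun k => -k, fun x => ?_⟩
    filter_upwards [Filter.eventually_ge_atTop ⌈-x⌉₊] with k hk
    have := (Nat.le_ceil (-x)).trans (Nat.cast_le.2 hk)
    push_cast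
    simp only [Set.mem_empty_iff_false, iff_false, not_lt]
    linarith
  by_cases hb : BddAbove L
  · set a := sSup L
    by_cases ha : a ∈ L
    · obtain ⟨u, -, hu, hlim⟩ :=
        (Rat.denseRange_cast (𝕜 := ℝ)).exists_seq_strictAnti_tendsto
          (Rat.cast_strictMono.monotone) a
      refine ⟨u, fun x => ?_⟩
      by_cases hx : x ∈ L
      · exact Filter.Eventually.of_forall fun k => by
          simpa [hx] using (le_csSup hb hx).trans_lt (hu k)
      · have hax : a < x := lt_of_not_ge fun h => hx (hL h ha)
        filter_upwards [hlim.eventually_lt_const hax] with k hk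
        simpa [hx] using le_of_lt hk
    · obtain ⟨u, -, hu, hlim⟩ :=
        (Rat.denseRange_cast (𝕜 := ℝ)).exists_seq_strictMono_tendsto
          (Rat.cast_strictMono.monotone) a
      refine ⟨u, fun x => ?_⟩
      by_cases hx : x ∈ L
      · have hax : x < a := lt_of_le_of_ne (le_csSup hb hx) fun h => ha (h ▸ hx)
        filter_upwards [hlim.eventually_const_lt hax] with k hk
        simpa [hx] using hk
      · have hax : a ≤ x := csSup_le hne fun y hy => le_of_not_ge fun h => hx (hL h hy)
        exact Filter.Eventually.of_forall fun k => by
          simpa [hx] using (le_of_lt (hu k)).trans hax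
  · refine ⟨fun k => k, fun x => ?_⟩
    have hx : x ∈ L := by
      obtain ⟨y, hy, hxy⟩ := not_bddAbove_iff.1 hb x
      exact hL hxy.le hy
    filter_upwards [Filter.eventually_ge_atTop (⌈x⌉₊ + 1)] with k hk
    have h1 : ((⌈x⌉₊ + 1 : ℕ) : ℝ) ≤ k := Nat.cast_le.2 hk
    have := Nat.le_ceil x
    push_cast at h1 ⊢
    simp only [hx, iff_true]
    linarith

theorem exists_rat_seq_of_ordConnected {I : Set ℝ} (hI : I.OrdConnected) :
    ∃ t : ℕ → ℚ × ℚ, ∀ x c : ℝ, ∀ᶠ k in Filter.atTop,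
      (if x < (t k).1 then c else 0) - (if x < (t k).2 then c else 0) =
        I.indicator (fun _ => c) x := by
  obtain ⟨p, hp⟩ := exists_rat_seq_of_isLowerSet (L := {x | ∃ y ∈ I, x ≤ y})
    fun a b hba ⟨y, hy, hay⟩ => ⟨y, hy, hba.trans hay⟩
  -- The first conjunct matters only for empty `I`, where the second is vacuous.
  obtain ⟨q, hq⟩ := exists_rat_seq_of_isLowerSet (L := {x | (∃ y ∈ I, x ≤ y) ∧ ∀ y ∈ I, x < y})
    fun a b hba ⟨⟨y, hy, hay⟩, h⟩ => ⟨⟨y, hy, hba.trans hay⟩, fun y hy => hba.trans_lt (h y hy)⟩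
  refine ⟨fun k => (p k, q k), fun x c => ?_⟩
  filter_upwards [hp x, hq x] with k hpk hqk
  replace hpk : x < p k ↔ ∃ y ∈ I, x ≤ y := hpk
  replace hqk : x < q k ↔ (∃ y ∈ I, x ≤ y) ∧ ∀ y ∈ I, x < y := hqk
  change (if x < p k then c else 0) - (if x < q k then c else 0) = _
  classical
  rw [if_congr hpk rfl rfl, if_congr hqk rfl rfl]
  by_cases hx : x ∈ I
  · rw [if_pos ⟨x, hx, le_rfl⟩, if_neg fun h => lt_irrefl _ (h.2 x hx)]
    simp [hx]
  · rw [Set.indicator_of_notMem hx]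
    by_cases h1 : ∃ y ∈ I, x ≤ y
    · rw [if_pos h1, if_pos, sub_self]
      refine ⟨h1, fun z hz => lt_of_not_ge fun hzx => hx ?_⟩
      obtain ⟨y, hy, hxy⟩ := h1
      exact hI.out hz hy ⟨hzx, hxy⟩
    · rw [if_neg h1, if_neg fun h => h1 h.1, sub_self]

section

variable {Ω : Type*} [MeasurableSpace Ω] {P : Measure Ω} [IsProbabilityMeasure P] {v w : Ω → ℝ}

/-- Dominated convergence passes the bound from rational half-line differences to every interval, so
measurability is needed only for a countable supremum. -/
theorem abs_interval_deviation_le_uniformDeviation (hv : Measurable v) (hw : Measurable w)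
    (hw1 : ∀ z, |w z| ≤ 1) {m : ℕ} (s : Fin m → Ω) {I : Set ℝ} (hI : I.OrdConnected) :
    |(1 / (m : ℝ)) * ∑ i, I.indicator (fun _ => w (s i)) (v (s i)) -
      ∫ z, I.indicator (fun _ => w z) (v z) ∂P| ≤ uniformDeviation P (halfLineDiff v w) s := by
  obtain ⟨t, ht⟩ := exists_rat_seq_of_ordConnected hI
  have hlim : ∀ z, Filter.Tendsto (fun k => halfLineDiff v w (t k) z) Filter.atTop
      (nhds (I.indicator (fun _ => w z) (v z))) := fun z =>
    tendsto_const_nhds.congr' ((ht (v z) (w z)).mono fun k hk => hk.symm)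
  have h1 := (tendsto_finsetSum Finset.univ fun i (_ : i ∈ Finset.univ) => hlim (s i)).const_mul
    (1 / (m : ℝ))
  have h2 : Filter.Tendsto (fun k => ∫ z, halfLineDiff v w (t k) z ∂P) Filter.atTop
      (nhds (∫ z, I.indicator (fun _ => w z) (v z) ∂P)) := by
    refine tendsto_integral_of_dominated_convergence (fun _ => 1)
      (fun k => (measurable_halfLineDiff hv hw _).aestronglyMeasurable) (integrable_const _)
      (fun k => ae_of_all _ fun z => ?_) (ae_of_all _ hlim)
    simpa using abs_halfLineDiff_le hw1 (t k) z
  exact le_of_tendsto (h1.sub h2).abs (Filter.Eventually.of_forall fun k =>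
    abs_deviation_le_uniformDeviation (fun t z => abs_halfLineDiff_le hw1 t z) s (t k))

/-- Uniform concentration over intervals. -/
theorem measure_uniformDeviation_halfLineDiff_ge_le (hv : Measurable v) (hw : Measurable w)
    (hw1 : ∀ z, |w z| ≤ 1) {m : ℕ} (hm : 0 < m) {r : ℝ} (hr : 0 ≤ r) :
    (Measure.pi fun _ : Fin m => P).real
      {s | (8 + r) / √(m : ℝ) ≤ uniformDeviation P (halfLineDiff v w) s} ≤
      Real.exp (-(r ^ 2 / 2)) := by
  have hm' : (0 : ℝ) < m := by exact_mod_cast hm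
  have hs : 0 < √(m : ℝ) := Real.sqrt_pos.2 hm'
  have hss : √(m : ℝ) ^ 2 = m := Real.sq_sqrt hm'.le
  have hg := measurable_halfLineDiff hv hw
  have hg1 := abs_halfLineDiff_le (v := v) hw1
  have hE := integral_uniformDeviation_le (P := P) hg hg1 hm
    (exists_signed_halfLineDiff_bound hm hw1)
  -- Replacing one observation moves a mean of `[-1, 1]`-valued terms by at most `2/m`; the exponent
  -- becomes `r²/2`.
  have hM := measure_ge_le_of_bounded_differences P (m := m) (b := 2 / m) (r := r / √m)
    (measurable_uniformDeviation (P := P) hg) (abs_uniformDeviation_le_two hg1)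
    (abs_uniformDeviation_update_sub_le hg1) hm (by positivity) (by positivity)
  refine (measureReal_mono fun s hs' => ?_).trans (hM.trans (le_of_eq ?_))
  · refine le_trans ?_ (Set.mem_ofPred_eq ▸ hs')
    rw [add_div]
    gcongr
    refine hE.trans (le_of_eq ?_)
    rw [div_eq_div_iff hm'.ne' hs.ne']
    nlinarith [hss]
  · congr 2
    rw [div_pow, hss]
    field_simp

/-- Hoeffding's inequality for an empirical mean. -/
theorem measure_abs_mean_sub_ge_le {h : Ω → ℝ} (hh : Measurable h) {K : ℝ} (hK : ∀ z, |h z| ≤ K)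
    (h1 : ∀ x y, |h x - h y| ≤ 1) {m : ℕ} (hm : 0 < m) {r : ℝ} (hr : 0 ≤ r) :
    (Measure.pi fun _ : Fin m => P).real
      {s | r ≤ |(1 / (m : ℝ)) * ∑ i, h (s i) - ∫ z, h z ∂P|} ≤
      2 * Real.exp (-(2 * m * r ^ 2)) := by
  have hm' : (0 : ℝ) < m := by exact_mod_cast hm
  have hone : ∀ h : Ω → ℝ, Measurable h → (∀ z, |h z| ≤ K) → (∀ x y, |h x - h y| ≤ 1) →
      (Measure.pi fun _ : Fin m => P).real
        {s | ∫ z, h z ∂P + r ≤ (1 / (m : ℝ)) * ∑ i, h (s i)} ≤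
        Real.exp (-(2 * m * r ^ 2)) := by
    intro h hh hK h1
    have hK0 : 0 ≤ K := by
      obtain ⟨x⟩ := nonempty_of_isProbabilityMeasure P
      exact (abs_nonneg _).trans (hK x)
    have hM := measure_ge_le_of_bounded_differences P (m := m) (b := 1 / m) (r := r)
      (F := fun s => (1 / (m : ℝ)) * ∑ i : Fin m, h (s i))
      ((Finset.measurable_sum _ fun i _ =>
        hh.comp (measurable_pi_apply (X := fun _ : Fin m => Ω) i)).const_mul _)
      (K := K) (fun s => abs_mean_le (m := m) hK0 fun i => hK (s i))
      (fun s i x => abs_sum_update_sub_le (m := m) h1 s i x) hm (by positivity) hr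
    have he : ∫ s, (1 / (m : ℝ)) * ∑ i : Fin m, h (s i) ∂(Measure.pi fun _ => P) = ∫ z, h z ∂P := by
      have hi : ∀ i : Fin m, Integrable (fun s : Fin m → Ω => h (s i)) (Measure.pi fun _ => P) :=
        fun i => integrable_of_abs_le (hh.comp (measurable_pi_apply i)) fun s => hK _
      rw [integral_const_mul, integral_finsetSum _ fun i _ => hi i]
      have : ∀ i : Fin m, ∫ s', h (s' i) ∂(Measure.pi fun _ => P) = ∫ z, h z ∂P := fun i =>
        integral_comp_eval (μ := fun _ : Fin m => P) hh.aestronglyMeasurable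
      simp_rw [this]
      simp
      field_simp
    rw [he] at hM
    refine hM.trans (le_of_eq ?_)
    congr 2
    field_simp
  have hp := hone h hh hK h1
  have hn := hone (fun z => -h z) hh.neg (fun z => by simpa using hK z)
    (fun x y => by rw [← neg_sub', abs_neg]; exact h1 x y)
  calc _ ≤ (Measure.pi fun _ : Fin m => P).real
        ({s | ∫ z, h z ∂P + r ≤ (1 / (m : ℝ)) * ∑ i, h (s i)} ∪
          {s | ∫ z, -h z ∂P + r ≤ (1 / (m : ℝ)) * ∑ i, -h (s i)}) := by
        refine measureReal_mono fun s hs => ?_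
        simp only [Set.mem_ofPred_eq, Set.mem_union, integral_neg, Finset.sum_neg_distrib,
          mul_neg] at hs ⊢
        rcases le_abs.1 hs with h | h
        · left; linarith
        · right; linarith
    _ ≤ _ := (measureReal_union_le _ _).trans (by linarith)

end

/-! ### Conditioning on the training half -/

/-- `S` may be nonmeasurable, as no regularity in the data is asked of the algorithm. Its measurable
hull has the same outer measure and larger sections, and Fubini applies to the hull. -/
theorem ofReal_le_measure_of_forall_section {α β γ : Type*} [MeasurableSpace α]
    [MeasurableSpace β] [MeasurableSpace γ] {μ : Measure α} {ν : Measure β} {ρ : Measure γ}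
    [IsProbabilityMeasure μ] [IsProbabilityMeasure ν] {ψ : α × β → γ}
    (hψ : MeasurePreserving ψ (μ.prod ν) ρ) (S : Set γ) {r : ENNReal}
    (h : ∀ x, r ≤ ν {y | ψ (x, y) ∈ S}) : r ≤ ρ S := by
  have hG := measurableSet_toMeasurable ρ S
  rw [← measure_toMeasurable S, ← hψ.measure_preimage hG.nullMeasurableSet,
    Measure.prod_apply (hψ.measurable hG)]
  calc r = ∫⁻ _, r ∂μ := by simp
    _ ≤ _ := lintegral_mono fun x => (h x).trans
      (measure_mono fun y hy => subset_toMeasurable ρ S hy)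

theorem exists_measurePreserving_halves {Ω : Type*} [MeasurableSpace Ω] (P : Measure Ω)
    [IsProbabilityMeasure P] (n : ℕ) :
    ∃ ψ : (Fin ((n + 1) / 2) → Ω) × (Fin (n / 2) → Ω) → (Fin n → Ω),
      MeasurePreserving ψ ((Measure.pi fun _ => P).prod (Measure.pi fun _ => P))
        (Measure.pi fun _ => P) ∧
      ∀ x y, firstHalf (ψ (x, y)) = x ∧ secondHalf (ψ (x, y)) = y := by
  let e : Fin ((n + 1) / 2) ⊕ Fin (n / 2) ≃ Fin n :=
    finSumFinEquiv.trans (finCongr (by omega))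
  have h1 := measurePreserving_sumPiEquivProdPi_symm
    (fun _ : Fin ((n + 1) / 2) ⊕ Fin (n / 2) => P)
  have h2 := measurePreserving_piCongrLeft (fun _ : Fin n => P) e
  refine ⟨_, h2.comp h1, fun x y => ⟨funext fun i => ?_, funext fun i => ?_⟩⟩
  · exact Equiv.piCongrLeft_apply_apply (fun _ => Ω) e _ (Sum.inl i)
  · exact Equiv.piCongrLeft_apply_apply (fun _ => Ω) e _ (Sum.inr i)

/-! ### Cutoff calibration error of the selected forecast -/

theorem abs_residual_le_one {𝒳 : Type*} (f : 𝒳 → unitInterval) (z : 𝒳 × unitInterval) :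
    |(z.2 : ℝ) - f z.1| ≤ 1 := by
  have h1 := z.2.2
  have h2 := (f z.1).2
  rw [abs_le]
  constructor <;> linarith [h1.1, h1.2, h2.1, h2.2]

section

variable {𝒳 : Type*} [MeasurableSpace 𝒳] {P : Measure (𝒳 × unitInterval)}
  [IsProbabilityMeasure P]

theorem measurable_forecast {f : 𝒳 → unitInterval} (hf : Measurable f) :
    Measurable fun z : 𝒳 × unitInterval => (f z.1 : ℝ) :=
  measurable_subtype_coe.comp (hf.comp measurable_fst)

theorem measurable_response : Measurable fun z : 𝒳 × unitInterval => (z.2 : ℝ) :=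
  measurable_subtype_coe.comp measurable_snd

theorem cutoffError_le_cutoffEstimate_add {f : 𝒳 → unitInterval} (hf : Measurable f) {m : ℕ}
    (s : Fin m → 𝒳 × unitInterval) :
    cutoffError P (fun x => (f x : ℝ)) ≤ cutoffEstimate s (fun x => (f x : ℝ)) +
      uniformDeviation P (halfLineDiff (fun z => (f z.1 : ℝ)) fun z => (z.2 : ℝ) - f z.1) s := by
  have : Nonempty {I : Set ℝ // I.OrdConnected} := ⟨⟨∅, Set.ordConnected_empty⟩⟩
  refine ciSup_le fun I => ?_
  have hd := abs_interval_deviation_le_uniformDeviation (P := P)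
    (w := fun z => (z.2 : ℝ) - f z.1) (measurable_forecast hf)
    (measurable_response.sub (measurable_forecast hf)) (abs_residual_le_one f) s I.2
  have hbdd : BddAbove (Set.range fun I : {I : Set ℝ // I.OrdConnected} =>
      |(1 / (m : ℝ)) * ∑ i, ((fun x => (f x : ℝ)) ⁻¹' I.1).indicator
        (fun x => ((s i).2 : ℝ) - f x) (s i).1|) :=
    bddAbove_range_of_abs_le fun I => abs_mean_le zero_le_one fun i => by
      rw [← Real.norm_eq_abs]
      exact (norm_indicator_le_norm_self _ _).trans (abs_residual_le_one f (s i))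
  have he : |(1 / (m : ℝ)) * ∑ i, ((fun x => (f x : ℝ)) ⁻¹' I.1).indicator
        (fun x => ((s i).2 : ℝ) - f x) (s i).1| ≤ cutoffEstimate s (fun x => (f x : ℝ)) :=
    le_ciSup hbdd I
  have ht := abs_sub_abs_le_abs_sub
    (∫ z, ((fun x => (f x : ℝ)) ⁻¹' I.1).indicator (fun x => (z.2 : ℝ) - f x) z.1 ∂P)
    ((1 / (m : ℝ)) * ∑ i, ((fun x => (f x : ℝ)) ⁻¹' I.1).indicator
        (fun x => ((s i).2 : ℝ) - f x) (s i).1)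
  rw [abs_sub_comm] at ht
  have hd' : |(1 / (m : ℝ)) * ∑ i, ((fun x => (f x : ℝ)) ⁻¹' I.1).indicator
        (fun x => ((s i).2 : ℝ) - f x) (s i).1 -
      ∫ z, ((fun x => (f x : ℝ)) ⁻¹' I.1).indicator (fun x => (z.2 : ℝ) - f x) z.1 ∂P| ≤ _ := hd
  linarith

/-- For a constant forecast an interval selects everything or nothing, so only the bias remains. -/
theorem cutoffError_const_le (a : ℝ) :
    cutoffError P (fun _ => a) ≤ |a - ∫ z, (z.2 : ℝ) ∂P| := by
  have : Nonempty {I : Set ℝ // I.OrdConnected} := ⟨⟨∅, Set.ordConnected_empty⟩⟩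
  refine ciSup_le fun I => ?_
  by_cases ha : a ∈ I.1
  · have hi : Integrable (fun z : 𝒳 × unitInterval => (z.2 : ℝ)) P :=
      integrable_of_abs_le measurable_response (K := 1) fun z => by
        rw [abs_of_nonneg z.2.2.1]; exact z.2.2.2
    simp only [Set.preimage_const_of_mem ha, Set.indicator_univ]
    rw [integral_sub hi (integrable_const _), abs_sub_comm]
    simp
  · simp [Set.preimage_const_of_notMem ha]

theorem measure_responseMean_ge_le {m : ℕ} (hm : 0 < m) {c : ℝ} (hc : 0 ≤ c) :
    (Measure.pi fun _ : Fin m => P).real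
      {s | c ≤ |responseMean s - ∫ z, (z.2 : ℝ) ∂P|} ≤ 2 * Real.exp (-(2 * m * c ^ 2)) :=
  measure_abs_mean_sub_ge_le (K := 1) measurable_response
    (fun z => by rw [abs_of_nonneg z.2.2.1]; exact z.2.2.2)
    (fun x y => by
      rw [abs_le]
      constructor <;> linarith [x.2.2.1, x.2.2.2, y.2.2.1, y.2.2.2]) hm hc

open Classical in
theorem measure_cutoffError_selected_gt_le {f : 𝒳 → unitInterval} (hf : Measurable f) {m : ℕ}
    (hm : 0 < m) {c δ : ℝ} (hδ0 : 0 < δ) (hδ1 : δ < 1)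
    (hc : √(Real.log (1 / δ) / (2 * (m : ℝ))) ≤ c) :
    (Measure.pi fun _ : Fin m => P).real
      {s | c < cutoffError P (if cutoffEstimate s (fun x => (f x : ℝ)) ≤
          c - (20 + √(2 * Real.log (1 / δ))) / √(m : ℝ)
        then (fun x => (f x : ℝ)) else fun _ => responseMean s)} ≤ 2 * δ := by
  have hm' : (0 : ℝ) < m := by exact_mod_cast hm
  have hs : 0 < √(m : ℝ) := Real.sqrt_pos.2 hm'
  set l := Real.log (1 / δ) with hl
  have hl0 : 0 ≤ l := Real.log_nonneg (by rw [le_div_iff₀ hδ0]; linarith)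
  have hδl : Real.exp (-l) = δ := by
    rw [hl, one_div, Real.log_inv, neg_neg, Real.exp_log hδ0]
  have hc0 : 0 ≤ c := (Real.sqrt_nonneg _).trans hc
  have hmean := measure_responseMean_ge_le (P := P) hm hc0
  set r := √(2 * l) with hr
  have hr0 : 0 ≤ r := Real.sqrt_nonneg _
  have hr2 : r ^ 2 = 2 * l := Real.sq_sqrt (by positivity)
  -- A nonnegative threshold forces `c` to be large, so each of the two failures costs at most `δ`.
  -- A negative one always yields the constant, and the whole `2δ` goes to Hoeffding.
  by_cases hτ : 0 ≤ c - (20 + r) / √(m : ℝ)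
  · have hdev := measure_uniformDeviation_halfLineDiff_ge_le (P := P) (measurable_forecast hf)
      (measurable_response.sub (measurable_forecast hf)) (abs_residual_le_one f) hm
      -- Chosen so that `8 + (12 + r)` is the `20 + r` of the threshold.
      (r := 12 + r) (by positivity)
    have hc2 : (20 + r) ^ 2 ≤ m * c ^ 2 := by
      have h1 : 20 + r ≤ c * √(m : ℝ) := by
        rw [sub_nonneg, div_le_iff₀ hs] at hτ; exact hτ
      calc (20 + r) ^ 2 ≤ (c * √(m : ℝ)) ^ 2 := by gcongr
        _ = m * c ^ 2 := by rw [mul_pow, Real.sq_sqrt hm'.le]; ring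
    have b1 : Real.exp (-((12 + r) ^ 2 / 2)) ≤ δ := by
      rw [← hδl, Real.exp_le_exp]; nlinarith
    -- Since `m c² ≥ (20 + r)²`, the exponent has room for an extra `exp (-1) ≤ 1/2`, which absorbs
    -- the two-sided factor 2.
    have b2 : 2 * Real.exp (-(2 * m * c ^ 2)) ≤ δ := by
      have : Real.exp (-(2 * m * c ^ 2)) ≤ Real.exp (-1 + -l) := Real.exp_le_exp.2 (by nlinarith)
      rw [Real.exp_add, hδl] at this
      have h2 : Real.exp (-1) ≤ 1 / 2 := by
        rw [Real.exp_neg, ← one_div]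
        exact one_div_le_one_div_of_le two_pos (by linarith [Real.add_one_le_exp (1 : ℝ)])
      nlinarith
    calc _ ≤ (Measure.pi fun _ : Fin m => P).real
          ({s | (8 + (12 + r)) / √(m : ℝ) ≤ uniformDeviation P
              (halfLineDiff (fun z => (f z.1 : ℝ)) fun z => (z.2 : ℝ) - f z.1) s} ∪
            {s | c ≤ |responseMean s - ∫ z, (z.2 : ℝ) ∂P|}) := by
          refine measureReal_mono fun s hs => ?_
          change c < cutoffError P _ at hs
          split_ifs at hs with h
          · left
            change (8 + (12 + r)) / √(m : ℝ) ≤ uniformDeviation P _ s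
            have := cutoffError_le_cutoffEstimate_add (P := P) hf s
            rw [← add_assoc]
            norm_num
            linarith
          · right
            exact hs.le.trans (cutoffError_const_le _)
      _ ≤ δ + δ := (measureReal_union_le _ _).trans
          (add_le_add (hdev.trans b1) (hmean.trans b2))
      _ = 2 * δ := by ring
  -- The assumed lower bound on `c` is exactly `log (1/δ) ≤ 2 m c²`.
  · have b : Real.exp (-(2 * m * c ^ 2)) ≤ δ := by
      rw [← hδl, Real.exp_le_exp, neg_le_neg_iff]
      have h1 := Real.sqrt_le_left hc0 |>.1 hc
      rw [div_le_iff₀ (by positivity)] at h1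
      linarith
    refine (measureReal_mono fun s hs => ?_).trans (hmean.trans (by linarith))
    change c < cutoffError P _ at hs
    have hest : 0 ≤ cutoffEstimate s (fun x => (f x : ℝ)) := Real.iSup_nonneg fun I => abs_nonneg _
    rw [if_neg fun h => hτ (hest.trans h)] at hs
    exact hs.le.trans (cutoffError_const_le _)

end

theorem corollary4p2 {𝒳 : Type*} [MeasurableSpace 𝒳]
    (P : Measure (𝒳 × unitInterval)) [IsProbabilityMeasure P]
    (n : ℕ) (hn : 2 ≤ n)
    (A : (Fin ((n + 1) / 2) → 𝒳 × unitInterval) → {f : 𝒳 → unitInterval // Measurable f})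
    (c δ : ℝ) (hδ0 : 0 < δ) (hδ1 : δ < 1)
    (hc : √(Real.log (1 / δ) / (2 * ((n / 2 : ℕ) : ℝ))) ≤ c) :
    1 - 2 * δ ≤ (Measure.pi fun _ : Fin n => P).real
      {s | cutoffError P (splitProcedure A c δ s) ≤ c} := by
  obtain ⟨ψ, hψ, hhalf⟩ := exists_measurePreserving_halves P n
  have hm : 0 < n / 2 := by omega
  rw [measureReal_def, ← ENNReal.ofReal_le_iff_le_toReal (measure_ne_top _ _)]
  refine ofReal_le_measure_of_forall_section hψ _ fun x => ?_
  rw [ENNReal.ofReal_le_iff_le_toReal (measure_ne_top _ _), ← measureReal_def]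
  set G := {y | ψ (x, y) ∈ {s | cutoffError P (splitProcedure A c δ s) ≤ c}} with hG
  have hbad : (Measure.pi fun _ : Fin (n / 2) => P).real Gᶜ ≤ 2 * δ := by
    refine le_trans (measureReal_mono fun y hy => ?_)
      (measure_cutoffError_selected_gt_le (P := P) (A x).2 hm hδ0 hδ1 hc)
    have hy' : ¬ cutoffError P (splitProcedure A c δ (ψ (x, y))) ≤ c := hy
    rw [splitProcedure, (hhalf x y).1, (hhalf x y).2] at hy'
    exact not_le.1 hy'
  have hun := measureReal_union_le (μ := Measure.pi fun _ : Fin (n / 2) => P) G Gᶜ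
  rw [Set.union_compl_self, probReal_univ] at hun
  linarith
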